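/- For a finite alphabet $\Sigma$ with $q \ge 2$ symbols and vectors $a=(a_0,\dots,a_{n-1})$, $b=(b_0,\dots,b_{n-1})\in\Sigma^n$, the pair distance $d_p(a,b)$ is the number of indices $i\in\{0,\dots,n-1\}$ with $(a_i,a_{i+1})\neq(b_i,b_{i+1})$, where indices are taken modulo $n$. The minimum pair distance of a code $\mathcal C\subseteq\Sigma^n$ is the minimum of $d_p(a,b)$ over all pairs of distinct $a,b\in\mathcal C$. An MDS $(n,d)_q$-symbol-pair code (with $2\le d\le n$) is a code of length $n$ over an alphabet of size $q$ whose minimum pair distance is exactly $d$ and which has exactly $q^{\,n-d+2}$ codewords (the maximum allowed by the Singleton-type bound for symbol-pair codes). A linear code $\mathcal C\subseteq\mathbb F_q^n$ is cyclic if it is carried onto itself by the shift $(x_0,\dots,x_{n-1})\mapsto(x_{n-1},x_0,\dots,x_{n-2})$; a cyclic code is called simple-root if $n$ is coprime to the characteristic of $\mathbb F_q$, and repeated-root otherwise. A linear code of length $n$, dimension $k$ and minimum Hamming distance $d_H$ is almost MDS if $d_H=n-k$. **Theorem 3.** The following hold. 1. For every prime $p\ge5$ there exists an MDS $(3p,7)_p$-symbol-pair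 code, which can be taken to be a repeated-root cyclic code over $\mathbb F_p$. 2. For every prime $p$ with $3\mid p-1$ there exists an MDS $(3p,8)_p$-symbol-pair code, which can be taken to be a repeated-root cyclic code over $\mathbb F_p$. 3. For every prime $p\ge5$ there exists an MDS $(3p,6)_p$-symbol-pair code, which can be taken to be a repeated-root cyclic code over $\mathbb F_p$. 4. For every prime power $q\ge3$ and every divisor $n\ge q+4$ of $q^2-1$ there exists an MDS $(n,6)_q$-symbol-pair code, which can be taken to be an almost MDS simple-root cyclic code over $\mathbb F_q$. -/

import Mathlib

namespace SymbolPair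

/-- The symbol-pair read vector `[(a₀,a₁), (a₁,a₂), …, (aₙ₋₁,a₀)]` of `a`; `finRotate n` is the
cyclic successor `i ↦ i + 1` on `Fin n`. -/
def readVector {α : Type*} {n : ℕ} (a : Fin n → α) : Fin n → α × α :=
  fun i => (a i, a (finRotate n i))

/-- The pair distance: the Hamming distance of the symbol-pair read vectors. -/
def pairDist {α : Type*} [DecidableEq α] {n : ℕ} (a b : Fin n → α) : ℕ :=
  hammingDist (readVector a) (readVector b)

/-- `d` is the minimum pair distance of the code `C` (in particular `C` has two codewords). -/
def IsMinPairDist {α : Type*} [DecidableEq α] {n : ℕ} (C : Set (Fin n → α)) (d : ℕ) : Prop :=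
  IsLeast {m : ℕ | ∃ a ∈ C, ∃ b ∈ C, a ≠ b ∧ pairDist a b = m} d

/-- `d` is the minimum Hamming distance of the code `C`. -/
def IsMinHammingDist {α : Type*} [DecidableEq α] {n : ℕ} (C : Set (Fin n → α)) (d : ℕ) : Prop :=
  IsLeast {m : ℕ | ∃ a ∈ C, ∃ b ∈ C, a ≠ b ∧ hammingDist a b = m} d

/-- `C` is an MDS `(n, d)_q`-symbol-pair code: an alphabet of `q ≥ 2` symbols, length `n`,
minimum pair distance `d` with `2 ≤ d ≤ n`, and exactly `q ^ (n - d + 2)` codewords. -/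
structure IsMDS {α : Type*} [DecidableEq α] {n : ℕ} (q d : ℕ) (C : Set (Fin n → α)) : Prop where
  card_alphabet : Nat.card α = q
  two_le_card : 2 ≤ q
  two_le_dist : 2 ≤ d
  dist_le_length : d ≤ n
  isMinPairDist : IsMinPairDist C d
  card_code : C.ncard = q ^ (n - d + 2)

/-- The cyclic shift `(x₀, x₁, …, xₙ₋₁) ↦ (xₙ₋₁, x₀, …, xₙ₋₂)`. -/
def cyclicShift (F : Type*) [Field F] (n : ℕ) : (Fin n → F) →ₗ[F] (Fin n → F) :=
  LinearMap.funLeft F F (finRotate n).symm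

/-- A linear code is cyclic if it is carried onto itself by the cyclic shift. -/
def IsCyclicCode {F : Type*} [Field F] {n : ℕ} (C : Submodule F (Fin n → F)) : Prop :=
  C.map (cyclicShift F n) = C

/-- A simple-root cyclic code: the length is coprime to the characteristic. -/
def IsSimpleRootCyclic {F : Type*} [Field F] {n : ℕ} (C : Submodule F (Fin n → F)) : Prop :=
  IsCyclicCode C ∧ n.Coprime (ringChar F)

/-- A repeated-root cyclic code: the length is not coprime to the characteristic. -/
def IsRepeatedRootCyclic {F : Type*} [Field F] {n : ℕ} (C : Submodule F (Fin n → F)) : Prop :=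
  IsCyclicCode C ∧ ¬ n.Coprime (ringChar F)

/-- `C` is an `[n, k, d]` linear code. -/
def HasParameters {F : Type*} [Field F] [DecidableEq F] {n : ℕ}
    (C : Submodule F (Fin n → F)) (k d : ℕ) : Prop :=
  Module.finrank F C = k ∧ IsMinHammingDist (C : Set (Fin n → F)) d

/-- An almost MDS linear code: an `[n, k, d]` code with `d = n - k`, one less than the
Singleton bound. -/
def IsAlmostMDS {F : Type*} [Field F] [DecidableEq F] {n : ℕ}
    (C : Submodule F (Fin n → F)) : Prop :=
  ∃ k d : ℕ, HasParameters C k d ∧ d + k = n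

end SymbolPair

namespace SymbolPair

open Finset

/-! ### Positions on a cycle. -/

section Rotation

variable {n : ℕ}

/-! The pair weight of a word is its Hamming weight plus the number of maximal cyclic runs of
nonzero entries that follow a zero (`pairDist_zero_eq`). Each code is the kernel of a linear map
onto which `isMDS_ker` applies: with a target of dimension `r`, it suffices that nonzero kernel
words have pair weight at least `r + 2`. Dimension, cardinality and sharpness of the distance then
follow by linear algebra.

For length `3p`, `x ^ (3p) - 1 = (x ^ 3 - 1) ^ p` over `ZMod p`. The codes for distances 6, 7, 8
have generators `(x - 1) ^ 2 (x ^ 2 + x + 1)`, `(x - 1) ^ 3 (x ^ 2 + x + 1)` and `(x - 1) ^ 3 (x -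
r) ^ 2 (x - r ^ 2)`, with `r` a primitive cube root of unity. By the Chinese remainder theorem a
position is a pair: a class `s` mod 3 and a coordinate `t` mod `p`. The zeros become vanishing
moments in `t`, weighted by functions of `s`, and Vandermonde (`eq_empty_or_lt_card_of_moments`)
bounds the weight in each class. Words are sorted by the number of classes they meet: one class
forces isolated entries, two classes force runs of length at most 2, three classes force weight at
least 6. The extremal shapes left over are excluded by `eq_zero_of_two_double_runs` (distance 7) and
`eq_zero_of_single_run_six` (distance 8).

The simple-root code has zeros `1, a, a ^ q, a ^ (q + 1)`, with `a` of order `n` in the quadratic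
extension. The Hartmann–Tzeng argument gives weight at least 4, and a run of four consecutive
entries is excluded by Vandermonde (`six_le_pairDist_of_evalAt`). A pigeonhole argument
(`exists_card_support_le_four`) supplies a word of weight 4, so the code is almost MDS. -/

theorem val_finRotate (i : Fin n) : (finRotate n i).val = (i.val + 1) % n := by
  have := i.neZero
  rw [finRotate_apply, Fin.val_add, Fin.val_one', Nat.add_mod_mod]

theorem val_finRotate_iterate (i : Fin n) (k : ℕ) :
    ((finRotate n)^[k] i).val = (i.val + k) % n := by
  induction k with
  | zero => simp [Nat.mod_eq_of_lt i.isLt]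
  | succ k ih => rw [Function.iterate_succ_apply', val_finRotate, ih, Nat.mod_add_mod, add_assoc]

theorem exists_finRotate_iterate_eq (i j : Fin n) : ∃ k, (finRotate n)^[k] i = j := by
  refine ⟨n - i.val + j.val, Fin.ext ?_⟩
  have hi := i.isLt
  have hj := j.isLt
  rw [val_finRotate_iterate, show i.val + (n - i.val + j.val) = j.val + n by omega,
    Nat.add_mod_right, Nat.mod_eq_of_lt hj]

theorem finRotate_iterate_injOn (i : Fin n) {a b : ℕ} (ha : a < n) (hb : b < n)
    (h : (finRotate n)^[a] i = (finRotate n)^[b] i) : a = b := by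
  have h' := congrArg Fin.val h
  rw [val_finRotate_iterate, val_finRotate_iterate] at h'
  have h2 : a ≡ b [MOD n] := Nat.ModEq.add_left_cancel' i.val h'
  exact Nat.ModEq.eq_of_lt_of_lt h2 ha hb

theorem cast_finRotate {m : ℕ} (hm : m ∣ n) (i : Fin n) :
    (((finRotate n i).val : ℕ) : ZMod m) = (i.val : ZMod m) + 1 := by
  rw [val_finRotate, ← Nat.cast_one (R := ZMod m), ← Nat.cast_add]
  exact (ZMod.natCast_eq_natCast_iff _ _ _).2 ((Nat.mod_modEq _ _).of_dvd hm)

end Rotation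

theorem eq_of_add_one_ne_of_add_two_ne {x a : ZMod 3} :
    x + 1 ≠ a → x + 1 + 1 ≠ a → x = a := by
  revert x a
  decide

/-! ### Pair weight in terms of runs. -/

section Runs

variable {F : Type*} [Field F] [DecidableEq F] {n : ℕ}

/-- The support of a word. -/
def support (c : Fin n → F) : Finset (Fin n) := univ.filter fun i => c i ≠ 0

/-- The positions that immediately precede a cyclic run of nonzero entries. -/
def runHeads (c : Fin n → F) : Finset (Fin n) :=
  univ.filter fun i => c i = 0 ∧ c (finRotate n i) ≠ 0

theorem mem_support {c : Fin n → F} {i : Fin n} : i ∈ support c ↔ c i ≠ 0 := by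
  simp [support]

theorem mem_runHeads {c : Fin n → F} {i : Fin n} :
    i ∈ runHeads c ↔ c i = 0 ∧ c (finRotate n i) ≠ 0 := by
  simp [runHeads]

theorem support_nonempty {c : Fin n → F} (hc : c ≠ 0) : (support c).Nonempty := by
  obtain ⟨i, hi⟩ := Function.ne_iff.1 hc
  exact ⟨i, mem_support.2 hi⟩

theorem hammingDist_eq_card_support (a b : Fin n → F) :
    hammingDist a b = (support (a - b)).card := by
  simp [hammingDist, support, sub_eq_zero]

theorem pairDist_eq_pairDist_sub_zero (a b : Fin n → F) : pairDist a b = pairDist (a - b) 0 := by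
  simp only [pairDist, hammingDist, readVector]
  congr 1
  ext i
  simp [sub_eq_zero]

/-- The pair read at `i` is nonzero exactly when `c i ≠ 0` or `i` is the zero just before a run, and
these cases exclude each other. -/
theorem pairDist_zero_eq (c : Fin n → F) :
    pairDist c 0 = (support c).card + (runHeads c).card := by
  have hd : Disjoint (support c) (runHeads c) := by
    rw [Finset.disjoint_left]
    intro i hi hi'
    exact mem_support.1 hi (mem_runHeads.1 hi').1
  rw [← card_union_of_disjoint hd]
  simp only [pairDist, hammingDist, readVector]
  congr 1
  ext i
  simp only [mem_union, mem_support, mem_runHeads, mem_filter, mem_univ, true_and, ne_eq,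
    Prod.mk.injEq, Pi.zero_apply]
  tauto

/-- Without a run head, a zero propagates forward around the whole cycle. -/
theorem runHeads_nonempty {c : Fin n → F} (hc : c ≠ 0) (hu : ∃ i, c i = 0) :
    (runHeads c).Nonempty := by
  by_contra h
  rw [not_nonempty_iff_eq_empty] at h
  obtain ⟨i, hi⟩ := hu
  apply hc
  funext j
  obtain ⟨k, rfl⟩ := exists_finRotate_iterate_eq i j
  induction k with
  | zero => simpa using hi
  | succ k ih =>
    by_contra hk
    rw [Function.iterate_succ_apply'] at hk
    have : (finRotate n)^[k] i ∈ runHeads c := mem_runHeads.2 ⟨ih, hk⟩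
    simp [h] at this

/-- A word with a zero has at least one run head, which gains 1 over the weight; a word without
zeros has pair weight `n`, whence the condition `m ≤ n`. -/
theorem pairDist_zero_ge {c : Fin n → F} (hc : c ≠ 0) {m : ℕ} (hm : m ≤ n)
    (h : m ≤ (support c).card + 1) : m ≤ pairDist c 0 := by
  rw [pairDist_zero_eq]
  by_cases hu : ∃ i, c i = 0
  · have := (runHeads_nonempty hc hu).card_pos
    omega
  · push Not at hu
    have : support c = univ := by ext i; simp [mem_support, hu i]
    simp [this]
    omega

/-- Every third position is zero, so runs have length at most 2 and each nonzero entry lies one or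
two steps after a run head. -/
theorem support_subset_of_missing_class {c : Fin n → F} {s : Fin n → ZMod 3}
    (hs : ∀ i, s (finRotate n i) = s i + 1) {a : ZMod 3} (ha : ∀ i, s i = a → c i = 0) :
    support c ⊆ (runHeads c).image (finRotate n) ∪
      (runHeads c).image (fun i => finRotate n (finRotate n i)) := by
  intro j hj
  rw [mem_support] at hj
  obtain ⟨i, rfl⟩ := (finRotate n).surjective j
  obtain ⟨k, rfl⟩ := (finRotate n).surjective i
  rw [mem_union, mem_image, mem_image]
  by_cases h1 : c (finRotate n k) = 0
  · exact Or.inl ⟨_, mem_runHeads.2 ⟨h1, hj⟩, rfl⟩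
  · refine Or.inr ⟨k, mem_runHeads.2 ⟨ha _ ?_, h1⟩, rfl⟩
    exact eq_of_add_one_ne_of_add_two_ne (fun h => h1 (ha _ (by rw [hs, h])))
      fun h => hj (ha _ (by rw [hs, hs, h]))

theorem card_support_le_two_mul {c : Fin n → F} {s : Fin n → ZMod 3}
    (hs : ∀ i, s (finRotate n i) = s i + 1) {a : ZMod 3} (ha : ∀ i, s i = a → c i = 0) :
    (support c).card ≤ 2 * (runHeads c).card :=
  calc (support c).card ≤ _ := card_le_card (support_subset_of_missing_class hs ha)
    _ ≤ _ := card_union_le _ _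
    _ ≤ (runHeads c).card + (runHeads c).card := add_le_add card_image_le card_image_le
    _ = _ := by ring

/-- Positions of one class are never adjacent, so every nonzero entry is a run by itself. -/
theorem card_support_le_card_runHeads {c : Fin n → F} {s : Fin n → ZMod 3}
    (hs : ∀ i, s (finRotate n i) = s i + 1) {a : ZMod 3} (ha : ∀ i, s i ≠ a → c i = 0) :
    (support c).card ≤ (runHeads c).card := by
  have hsub : support c ⊆ (runHeads c).image (finRotate n) := by
    intro j hj
    rw [mem_support] at hj
    obtain ⟨i, rfl⟩ := (finRotate n).surjective j
    refine mem_image.2 ⟨i, mem_runHeads.2 ⟨ha _ fun h => hj (ha _ ?_), hj⟩, rfl⟩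
    rw [hs, h]
    simp
  exact (card_le_card hsub).trans card_image_le

/-- A word with a single run of nonzero entries is supported on consecutive positions. -/
theorem support_subset_of_runHeads_eq_singleton {c : Fin n → F} {h : Fin n}
    (hh : runHeads c = {h}) :
    support c ⊆ (range (support c).card).image fun k => (finRotate n)^[k] (finRotate n h) := by
  intro j hj
  have hh0 : c h = 0 := (mem_runHeads.1 (hh ▸ mem_singleton_self h)).1
  have hex := exists_finRotate_iterate_eq (finRotate n h) j
  classical
  let k := Nat.find hex
  have hk : (finRotate n)^[k] (finRotate n h) = j := Nat.find_spec hex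
  have hinj : ∀ a ≤ k, ∀ b ≤ k, a < b →
      (finRotate n)^[a] (finRotate n h) ≠ (finRotate n)^[b] (finRotate n h) := by
    intro a _ b hb hab he
    have : (finRotate n)^[k - b + a] (finRotate n h) = j := by
      rw [Function.iterate_add_apply, he, ← Function.iterate_add_apply, Nat.sub_add_cancel hb, hk]
    have := Nat.find_min' hex this
    change k ≤ _ at this
    omega
  -- Walk back from `j` to the start of the run: a zero met on the way would be a run head, hence
  -- `h`, and the walk would pass `finRotate n h` a second time, against the minimality of `k`.
  have hne : ∀ d ≤ k, c ((finRotate n)^[k - d] (finRotate n h)) ≠ 0 := by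
    intro d
    induction d with
    | zero => intro _; rw [Nat.sub_zero, hk]; exact mem_support.1 hj
    | succ d ih =>
      intro hd h0
      have hmem : (finRotate n)^[k - (d + 1)] (finRotate n h) ∈ runHeads c := by
        refine mem_runHeads.2 ⟨h0, ?_⟩
        rw [← Function.iterate_succ_apply' (finRotate n), show (k - (d + 1)).succ = k - d by omega]
        exact ih (by omega)
      rw [hh, mem_singleton] at hmem
      refine hinj 0 (by omega) (k - (d + 1) + 1) (by omega) (by omega) ?_
      rw [Function.iterate_succ_apply', hmem]
      rfl
  have hcard : k + 1 ≤ (support c).card := by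
    have hsub : (range (k + 1)).image (fun k => (finRotate n)^[k] (finRotate n h)) ⊆ support c := by
      intro x hx
      obtain ⟨a, ha, rfl⟩ := mem_image.1 hx
      have ha' := mem_range.1 ha
      have := hne (k - a) (by omega)
      rw [show k - (k - a) = a by omega] at this
      exact mem_support.2 this
    have := card_le_card hsub
    rwa [card_image_of_injOn, card_range] at this
    intro a ha b hb hab
    have ha' := mem_range.1 ha
    have hb' := mem_range.1 hb
    rcases lt_trichotomy a b with h1 | h1 | h1
    · exact absurd hab (hinj a (by omega) b (by omega) h1)
    · exact h1
    · exact absurd hab.symm (hinj b (by omega) a (by omega) h1)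
  exact mem_image.2 ⟨k, mem_range.2 (by omega), hk⟩

theorem sum_eq_of_runHeads_eq_singleton {c : Fin n → F} {h : Fin n}
    (hh : runHeads c = {h}) (hn : (support c).card ≤ n) {M : Type*} [AddCommMonoid M]
    (f : Fin n → M) (hf : ∀ i, c i = 0 → f i = 0) :
    ∑ i, f i = ∑ k ∈ range (support c).card, f ((finRotate n)^[k] (finRotate n h)) := by
  rw [← sum_image (f := f) (g := fun k => (finRotate n)^[k] (finRotate n h))]
  · symm
    apply sum_subset (subset_univ _)
    intro i _ hi
    apply hf
    by_contra h0
    exact hi (support_subset_of_runHeads_eq_singleton hh (mem_support.2 h0))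
  · intro a ha b hb hab
    exact finRotate_iterate_injOn _ ((mem_range.1 ha).trans_le hn) ((mem_range.1 hb).trans_le hn) hab

end Runs

/-! ### Codes as kernels: dimension, cardinality, cyclicity. -/

section Kernel

variable {F : Type*} [Field F] {n : ℕ} {W : Type*} [AddCommGroup W] [Module F W]

/-- A linear map vanishes on a nonzero word supported on any given set of more positions than the
dimension of its target. -/
theorem exists_mem_ker_supported [FiniteDimensional F W] (L : (Fin n → F) →ₗ[F] W)
    (A : Finset (Fin n)) (hA : Module.finrank F W < A.card) :
    ∃ c ≠ 0, L c = 0 ∧ ∀ i ∉ A, c i = 0 := by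
  classical
  let E : (A → F) →ₗ[F] (Fin n → F) := Function.ExtendByZero.linearMap F Subtype.val
  have hE : ∀ (v : A → F) (i : A), E v i = v i := fun v i =>
    Function.Injective.extend_apply Subtype.val_injective v (0 : Fin n → F) i
  have hE0 : ∀ (v : A → F) (i : Fin n), i ∉ A → E v i = 0 := fun v i hi => by
    refine Function.extend_apply' v (0 : Fin n → F) i ?_
    rintro ⟨a, rfl⟩
    exact hi a.2
  obtain ⟨v, hv, hv0⟩ := (L ∘ₗ E).ker.ne_bot_iff.1
    (LinearMap.ker_ne_bot_of_finrank_lt (f := L ∘ₗ E) (by simpa using hA))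
  refine ⟨E v, fun h => hv0 (funext fun i => ?_), hv, hE0 v⟩
  rw [← hE v i, h]
  rfl

/-- Only the pairs read at `n - 1, 0, …, m - 1` can be nonzero. -/
theorem pairDist_le_of_supported [DecidableEq F] {c : Fin n → F} {m : ℕ}
    (hc : ∀ i : Fin n, m ≤ i.val → c i = 0) (hm : m < n) : pairDist c 0 ≤ m + 1 := by
  have hsub : univ.filter (fun i => readVector c i ≠ readVector (0 : Fin n → F) i) ⊆
      (range (m + 1)).image fun k => (finRotate n)^[k] ⟨n - 1, by omega⟩ := by
    intro i hi
    have hi' : ¬ (c i = 0 ∧ c (finRotate n i) = 0) := by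
      simpa [readVector] using hi
    rw [mem_image]
    by_cases h : i.val < m
    · refine ⟨i.val + 1, mem_range.2 (by omega), Fin.ext ?_⟩
      rw [val_finRotate_iterate]
      simp only
      rw [show n - 1 + (i.val + 1) = i.val + n by omega, Nat.add_mod_right,
        Nat.mod_eq_of_lt i.isLt]
    · have hci := hc i (not_lt.1 h)
      have hcr : ¬ m ≤ (finRotate n i).val := fun h' => hi' ⟨hci, hc _ h'⟩
      rw [val_finRotate] at hcr
      refine ⟨0, mem_range.2 (by omega), Fin.ext ?_⟩
      simp only [Function.iterate_zero, id]
      by_contra hne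
      rw [Nat.mod_eq_of_lt (by have := i.isLt; omega)] at hcr
      omega
  calc pairDist c 0 ≤ _ := card_le_card hsub
    _ ≤ _ := card_image_le
    _ = m + 1 := card_range _

/-- `L` has full rank: a word on the first `r` positions has pair weight at most `r + 1`, so `L` is
injective on such words. -/
theorem finrank_ker_of_pairDist [DecidableEq F] [FiniteDimensional F W] {r : ℕ}
    (hW : Module.finrank F W = r)
    (hr : r + 2 ≤ n) (L : (Fin n → F) →ₗ[F] W)
    (hL : ∀ c, L c = 0 → c ≠ 0 → r + 2 ≤ pairDist c 0) :
    Module.finrank F (LinearMap.ker L) = n - r := by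
  have h1 := L.finrank_range_add_finrank_ker
  rw [Module.finrank_fin_fun] at h1
  have h2 := (LinearMap.range L).finrank_le
  suffices r ≤ Module.finrank F (LinearMap.range L) by omega
  let E : (Fin r → F) →ₗ[F] (Fin n → F) :=
    Function.ExtendByZero.linearMap F (Fin.castLE (by omega : r ≤ n))
  have hinj : Function.Injective (L ∘ₗ E) := by
    rw [← LinearMap.ker_eq_bot, LinearMap.ker_eq_bot']
    intro v hv
    by_contra hv0
    have hE : ∀ i, E v (Fin.castLE (by omega) i) = v i := fun i =>
      Function.Injective.extend_apply (Fin.castLE_injective _) v (0 : Fin n → F) i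
    have hne : E v ≠ 0 := fun h => hv0 (funext fun i => by rw [← hE, h]; rfl)
    have h3 := hL _ hv hne
    have h4 : pairDist (E v) 0 ≤ r + 1 := by
      refine pairDist_le_of_supported (fun i hi => ?_) (by omega)
      refine Function.extend_apply' v (0 : Fin n → F) i ?_
      rintro ⟨a, rfl⟩
      have := a.isLt
      simp at hi
      omega
    omega
  have h5 := LinearMap.finrank_range_of_inj hinj
  rw [Module.finrank_fin_fun] at h5
  rw [← h5]
  exact Submodule.finrank_mono (LinearMap.range_comp_le_range E L)

theorem isMDS_ker [DecidableEq F] [Fintype F] [FiniteDimensional F W] {r : ℕ}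
    (hW : Module.finrank F W = r) (hr : r + 2 ≤ n) (L : (Fin n → F) →ₗ[F] W)
    (hL : ∀ c, L c = 0 → c ≠ 0 → r + 2 ≤ pairDist c 0) :
    IsMDS (Fintype.card F) (r + 2) (LinearMap.ker L : Set (Fin n → F)) where
  card_alphabet := Nat.card_eq_fintype_card
  two_le_card := Fintype.one_lt_card
  two_le_dist := by omega
  dist_le_length := hr
  isMinPairDist := by
    constructor
    -- `r + 1` positions exceed the dimension of `W`, so some nonzero kernel word lives on the first
    -- `r + 1` positions and has pair weight at most `r + 2`.
    · obtain ⟨c, hc, hLc, hs⟩ := exists_mem_ker_supported L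
        (univ.filter fun i : Fin n => i.val < r + 1) (by
          rw [hW, Fin.card_filter_val_lt]
          omega)
      refine ⟨c, hLc, 0, Submodule.zero_mem _, hc, le_antisymm ?_ (hL c hLc hc)⟩
      refine pairDist_le_of_supported (fun i hi => hs i ?_) (by omega)
      simpa using hi
    · rintro m ⟨a, ha, b, hb, hab, rfl⟩
      rw [pairDist_eq_pairDist_sub_zero]
      exact hL _ (Submodule.sub_mem _ ha hb) (sub_ne_zero.2 hab)
  card_code := by
    rw [← Nat.card_coe_set_eq, SetLike.coe_sort_coe, Module.natCard_eq_pow_finrank (K := F),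
      finrank_ker_of_pairDist hW hr L hL, Nat.card_eq_fintype_card]
    congr 1
    omega

theorem isCyclicCode_of_le {C : Submodule F (Fin n → F)}
    (h : ∀ c ∈ C, cyclicShift F n c ∈ C) : IsCyclicCode C := by
  have hinj : Function.Injective (cyclicShift F n) :=
    LinearMap.funLeft_injective_of_surjective F F _ (finRotate n).symm.surjective
  refine Submodule.eq_of_le_of_finrank_eq ?_ ?_
  · rintro _ ⟨c, hc, rfl⟩
    exact h c hc
  · exact (Submodule.equivMapOfInjective _ hinj C).finrank_eq.symm

theorem sum_cyclicShift {M : Type*} [AddCommMonoid M] (c : Fin n → F) (g : F → Fin n → M) :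
    ∑ i, g (cyclicShift F n c i) i = ∑ i, g (c i) (finRotate n i) := by
  rw [← Equiv.sum_comp (finRotate n)]
  simp only [cyclicShift, LinearMap.funLeft_apply, Equiv.symm_apply_apply]

end Kernel

/-! ### Vandermonde bound. -/

/-- If `A` had between 1 and `m` points, a Lagrange basis polynomial on the nodes would have degree
below `m`; pairing it with the moments isolates a single `c i`, which would then vanish. -/
theorem eq_empty_or_lt_card_of_moments {F ι : Type*} [Field F] {A : Finset ι} {t c : ι → F}
    {m : ℕ} (ht : Set.InjOn t A) (hc : ∀ i ∈ A, c i ≠ 0)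
    (h : ∀ k < m, ∑ i ∈ A, c i * t i ^ k = 0) : A = ∅ ∨ m < A.card := by
  classical
  by_contra! hcon
  obtain ⟨i, hi⟩ := hcon.1
  let P := Lagrange.basis A t i
  have hdeg : P.natDegree < m := by
    have h1 : P.natDegree = A.card - 1 :=
      Polynomial.natDegree_eq_of_degree_eq_some (Lagrange.degree_basis ht hi)
    have := card_pos.2 hcon.1
    omega
  have hz : ∑ j ∈ A, c j * P.eval (t j) = 0 := by
    simp_rw [Polynomial.eval_eq_sum_range' hdeg, mul_sum]
    rw [sum_comm]
    refine sum_eq_zero fun k hk => ?_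
    rw [← mul_zero (P.coeff k), ← h k (mem_range.1 hk), mul_sum]
    exact sum_congr rfl fun j _ => by ring
  rw [sum_eq_single_of_mem i hi fun j hj hji => by
    rw [Lagrange.eval_basis_of_ne hji.symm hj, mul_zero], Lagrange.eval_basis_self ht hi,
    mul_one] at hz
  exact hc i hi hz

theorem sum_zmod_three {M : Type*} [AddCommMonoid M] (g : ZMod 3 → M) (a : ZMod 3) :
    ∑ b, g b = g a + g (a + 1) + g (a + 2) := by
  have huniv : ∀ a : ZMod 3, (univ : Finset (ZMod 3)) = {a, a + 1, a + 2} := by decide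
  have h1 : ∀ a : ZMod 3, a ∉ ({a + 1, a + 2} : Finset (ZMod 3)) := by decide
  have h2 : ∀ a : ZMod 3, a + 1 ∉ ({a + 2} : Finset (ZMod 3)) := by decide
  rw [huniv a, sum_insert (h1 a), sum_insert (h2 a), sum_singleton, add_assoc]

/-! ### Moments over classes mod 3. -/

section Moments

variable {F : Type*} [Field F] {n : ℕ} (s : Fin n → ZMod 3) (t : Fin n → F)

/-- The functional `c ↦ ∑ i, w (s i) * t i ^ k * c i`. -/
def moment (w : ZMod 3 → F) (k : ℕ) : (Fin n → F) →ₗ[F] F :=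
  ∑ i, (w (s i) * t i ^ k) • LinearMap.proj i

/-- The `k`-th moments of the restrictions of a word to the classes of `s`. -/
def classMoment (k : ℕ) : (Fin n → F) →ₗ[F] (ZMod 3 → F) :=
  LinearMap.pi fun a => moment s t (Pi.single a 1) k

variable {s t}

theorem moment_apply (w : ZMod 3 → F) (k : ℕ) (c : Fin n → F) :
    moment s t w k c = ∑ i, w (s i) * t i ^ k * c i := by
  simp [moment]

theorem classMoment_apply (k : ℕ) (c : Fin n → F) (a : ZMod 3) :
    classMoment s t k c a = ∑ i, (Pi.single a 1 : ZMod 3 → F) (s i) * t i ^ k * c i :=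
  moment_apply _ _ _

theorem moment_eq_sum_classMoment (w : ZMod 3 → F) (k : ℕ) (c : Fin n → F) :
    moment s t w k c = ∑ a, w a * classMoment s t k c a := by
  simp_rw [classMoment_apply, moment_apply, mul_sum]
  rw [sum_comm]
  refine sum_congr rfl fun i _ => ?_
  rw [sum_eq_single (s i)]
  · simp; ring
  · intro a _ ha
    simp [Pi.single_eq_of_ne ha.symm]
  · simp

theorem moment_zero_eq_zero {c : Fin n → F} (h : classMoment s t 0 c = 0) (w : ZMod 3 → F) :
    moment s t w 0 c = 0 := by
  simp [moment_eq_sum_classMoment, h]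

theorem classMoment_eq_zero {c : Fin n → F} {a : ZMod 3} (h : ∀ i, s i = a → c i = 0) (k : ℕ) :
    classMoment s t k c a = 0 := by
  rw [classMoment_apply]
  refine sum_eq_zero fun i _ => ?_
  by_cases hi : s i = a
  · simp [h i hi]
  · simp [Pi.single_eq_of_ne hi]

theorem moment_cyclicShift (hs : ∀ i, s (finRotate n i) = s i + 1)
    (ht : ∀ i, t (finRotate n i) = t i + 1) (w : ZMod 3 → F) (k : ℕ) (c : Fin n → F) :
    moment s t w k (cyclicShift F n c) = ∑ i, w (s i + 1) * (t i + 1) ^ k * c i := by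
  rw [moment_apply, sum_cyclicShift c fun x i => w (s i) * t i ^ k * x]
  simp_rw [hs, ht]

theorem classMoment_zero_cyclicShift (hs : ∀ i, s (finRotate n i) = s i + 1)
    (ht : ∀ i, t (finRotate n i) = t i + 1) {c : Fin n → F} (h : classMoment s t 0 c = 0) :
    classMoment s t 0 (cyclicShift F n c) = 0 := by
  funext a
  have := moment_zero_eq_zero h fun b => (Pi.single a 1 : ZMod 3 → F) (b + 1)
  rw [moment_apply] at this
  exact (moment_cyclicShift hs ht _ _ _).trans (by simpa using this)

/-- The shift replaces `t` by `t + 1` and multiplies `w` by `r`, so the new first moment is `r`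
times the old first moment plus the zeroth. -/
theorem moment_one_cyclicShift (hs : ∀ i, s (finRotate n i) = s i + 1)
    (ht : ∀ i, t (finRotate n i) = t i + 1) {w : ZMod 3 → F} {r : F}
    (hw : ∀ a, w (a + 1) = r * w a) {c : Fin n → F} (h : classMoment s t 0 c = 0)
    (h1 : moment s t w 1 c = 0) : moment s t w 1 (cyclicShift F n c) = 0 := by
  have h0 := moment_zero_eq_zero h w
  have : r * (moment s t w 1 c + moment s t w 0 c) = 0 := by rw [h0, h1]; ring
  rw [moment_cyclicShift hs ht, ← this, moment_apply, moment_apply, ← sum_add_distrib, mul_sum]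
  exact sum_congr rfl fun i _ => by rw [hw]; ring

theorem moment_two_cyclicShift (hs : ∀ i, s (finRotate n i) = s i + 1)
    (ht : ∀ i, t (finRotate n i) = t i + 1) {c : Fin n → F} (h : classMoment s t 0 c = 0)
    (h1 : moment s t 1 1 c = 0) (h2 : moment s t 1 2 c = 0) :
    moment s t 1 2 (cyclicShift F n c) = 0 := by
  have h0 := moment_zero_eq_zero h 1
  have : moment s t 1 2 c + 2 * moment s t 1 1 c + moment s t 1 0 c = 0 := by
    rw [h0, h1, h2]; ring
  rw [moment_cyclicShift hs ht, ← this, moment_apply, moment_apply, moment_apply, mul_sum,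
    ← sum_add_distrib, ← sum_add_distrib]
  exact sum_congr rfl fun i _ => by simp only [Pi.one_apply]; ring

variable [DecidableEq F]

/-- The part of the support of `c` in the class `a`. -/
def classSupport (s : Fin n → ZMod 3) (c : Fin n → F) (a : ZMod 3) : Finset (Fin n) :=
  (support c).filter fun i => s i = a

theorem classSupport_eq_empty {c : Fin n → F} {a : ZMod 3} :
    classSupport s c a = ∅ ↔ ∀ i, s i = a → c i = 0 := by
  simp only [classSupport, filter_eq_empty_iff, mem_support]
  exact ⟨fun h i hi => by by_contra h0; exact h h0 hi, fun h i hi ha => hi (h i ha)⟩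

theorem card_support_eq (s : Fin n → ZMod 3) (c : Fin n → F) (a : ZMod 3) :
    (support c).card = (classSupport s c a).card + (classSupport s c (a + 1)).card +
      (classSupport s c (a + 2)).card := by
  rw [← sum_zmod_three (fun b => (classSupport s c b).card)]
  exact card_eq_sum_card_fiberwise fun i _ => mem_coe.2 (mem_univ (s i))

theorem lt_card_classSupport (hst : ∀ i j, s i = s j → t i = t j → i = j) {c : Fin n → F}
    {a : ZMod 3} {m : ℕ} (h : ∀ k < m, classMoment s t k c a = 0)
    (hne : classSupport s c a ≠ ∅) : m < (classSupport s c a).card := by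
  refine (eq_empty_or_lt_card_of_moments (t := t) (c := c) ?_ ?_ ?_).resolve_left hne
  · intro i hi j hj hij
    refine hst i j ?_ hij
    rw [(mem_filter.1 (mem_coe.1 hi)).2, (mem_filter.1 (mem_coe.1 hj)).2]
  · exact fun i hi => mem_support.1 (mem_filter.1 hi).1
  · intro k hk
    rw [← h k hk, classMoment_apply, classSupport, sum_filter, support, sum_filter]
    refine sum_congr rfl fun i _ => ?_
    by_cases hc : c i = 0 <;> by_cases hi : s i = a
    · simp [hc]
    · simp [hc]
    · subst hi; simp [hc, mul_comm]
    · simp [hi]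

/-- A nonzero word meets one, two or three of the classes. -/
theorem classSupport_cases (s : Fin n → ZMod 3) {c : Fin n → F} (hc : c ≠ 0) :
    (∃ a, classSupport s c a ≠ ∅ ∧ ∀ b ≠ a, classSupport s c b = ∅) ∨
    (∃ a, classSupport s c a = ∅ ∧ classSupport s c (a + 1) ≠ ∅ ∧
      classSupport s c (a + 2) ≠ ∅) ∨
    ∀ a, classSupport s c a ≠ ∅ := by
  have h0 : ∃ a, classSupport s c a ≠ ∅ := by
    obtain ⟨i, hi⟩ := support_nonempty hc
    exact ⟨s i, ne_empty_of_mem (mem_filter.2 ⟨hi, rfl⟩)⟩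
  generalize classSupport s c = S at *
  have key : ∀ P : ZMod 3 → Prop, (∃ a, P a) → (∃ a, P a ∧ ∀ b ≠ a, ¬ P b) ∨
      (∃ a, ¬ P a ∧ P (a + 1) ∧ P (a + 2)) ∨ ∀ a, P a := by
    intro P
    -- Boolean predicates reduce the claim to a finite check.
    have : ∀ f : ZMod 3 → Bool, (∃ a, f a) → (∃ a, f a ∧ ∀ b ≠ a, ¬ f b) ∨
      (∃ a, ¬ f a ∧ f (a + 1) ∧ f (a + 2)) ∨ ∀ a, f a := by decide
    classical
    simpa using this fun a => decide (P a)
  simpa using key (fun a => S a ≠ ∅) h0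

/-- Equality case of `card_support_le_two_mul`: the support consists of two runs of length exactly
2, each starting right after a position of the missing class. -/
theorem support_eq_of_missing_class (hs : ∀ i, s (finRotate n i) = s i + 1) {c : Fin n → F}
    {a : ZMod 3} (ha : ∀ i, s i = a → c i = 0) (h4 : (support c).card = 4)
    (h2 : (runHeads c).card = 2) : ∃ h k, s h = a ∧ s k = a ∧ h ≠ k ∧ c (finRotate n h) ≠ 0 ∧
      ∀ f : Fin n → F, (∀ i, c i = 0 → f i = 0) → ∑ i, f i =
        f (finRotate n h) + f (finRotate n (finRotate n h)) +
          f (finRotate n k) + f (finRotate n (finRotate n k)) := by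
  obtain ⟨h, k, hhk, hR⟩ := card_eq_two.1 h2
  have hsub := support_subset_of_missing_class hs ha
  rw [hR] at hsub
  have hh := mem_runHeads.1 (hR ▸ mem_insert_self h {k} : h ∈ runHeads c)
  let l : List (Fin n) := [finRotate n h, finRotate n (finRotate n h), finRotate n k,
    finRotate n (finRotate n k)]
  have hS : support c ⊆ l.toFinset := by
    intro x hx
    have := hsub hx
    simp only [image_insert, image_singleton, mem_union, mem_insert, mem_singleton] at this
    simp only [l, List.mem_toFinset, List.mem_cons, List.not_mem_nil, or_false]
    tauto
  have hle := l.toFinset_card_le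
  have hlS : support c = l.toFinset := eq_of_subset_of_card_le hS (by rw [h4]; exact hle)
  -- Four listed positions cover a support of size 4, so there is no repetition.
  have hnd : l.Nodup := by
    refine Multiset.coe_nodup.1 (Multiset.toFinset_card_eq_card_iff_nodup.1 ?_)
    exact (congrArg card hlS).symm.trans h4
  have hmem : ∀ x ∈ l, s x ≠ a := fun x hx hxa => by
    have : x ∈ support c := hlS ▸ List.mem_toFinset.2 hx
    exact mem_support.1 this (ha x hxa)
  have hclass : ∀ x : Fin n, s (finRotate n x) ≠ a → s (finRotate n (finRotate n x)) ≠ a →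
      s x = a := by
    intro x
    rw [hs, hs, hs]
    exact eq_of_add_one_ne_of_add_two_ne
  refine ⟨h, k, hclass h (hmem _ (by simp [l])) (hmem _ (by simp [l])),
    hclass k (hmem _ (by simp [l])) (hmem _ (by simp [l])), hhk, hh.2, fun f hf => ?_⟩
  rw [← sum_subset (subset_univ (support c)) fun i _ hi => hf i (by
    by_contra h0; exact hi (mem_support.2 h0)), hlS, List.sum_toFinset f hnd]
  simp [l, add_assoc]

end Moments

/-! ### Pair weight bounds 6, 7 and 8 for length `3p`. -/

section Distance

variable {F : Type*} [Field F] [DecidableEq F] {n : ℕ} {s : Fin n → ZMod 3} {t : Fin n → F}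

theorem classMoment_eq_zero_of_single_class {c : Fin n → F} {a : ZMod 3}
    (ha : ∀ b ≠ a, classSupport s c b = ∅) {k : ℕ} (h : moment s t 1 k c = 0) :
    classMoment s t k c a = 0 := by
  rw [moment_eq_sum_classMoment, sum_eq_single a] at h
  · simpa using h
  · intro b _ hb
    rw [classMoment_eq_zero (classSupport_eq_empty.1 (ha b hb)), mul_zero]
  · simp

theorem two_mul_le_pairDist_of_single_class (hs : ∀ i, s (finRotate n i) = s i + 1)
    {c : Fin n → F} {a : ZMod 3} (ha : ∀ b ≠ a, classSupport s c b = ∅) :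
    2 * (classSupport s c a).card ≤ pairDist c 0 := by
  have h1 := card_support_le_card_runHeads hs (c := c) (a := a)
    fun i hi => classSupport_eq_empty.1 (ha _ hi) i rfl
  have h2 := card_support_eq s c a
  rw [pairDist_zero_eq]
  omega

theorem one_lt_card_classSupport (hst : ∀ i j, s i = s j → t i = t j → i = j) {c : Fin n → F}
    (h0 : classMoment s t 0 c = 0) {a : ZMod 3} (ha : classSupport s c a ≠ ∅) :
    1 < (classSupport s c a).card := by
  refine lt_card_classSupport hst (fun k hk => ?_) ha
  rw [Nat.lt_one_iff.1 hk, h0, Pi.zero_apply]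

/-- By number of classes met: one class gives 3 isolated entries, so `3 + 3`; two classes give
weight 4 in runs of length at most 2, so `4 + 2`; three classes give weight 6 already. -/
theorem six_le_pairDist (hs : ∀ i, s (finRotate n i) = s i + 1)
    (hst : ∀ i j, s i = s j → t i = t j → i = j) {c : Fin n → F} (hc : c ≠ 0)
    (h0 : classMoment s t 0 c = 0) (h1 : moment s t 1 1 c = 0) : 6 ≤ pairDist c 0 := by
  have hd := pairDist_zero_eq c
  rcases classSupport_cases s hc with ⟨a, ha, hb⟩ | ⟨a, ha, ha1, ha2⟩ | h
  · have := two_mul_le_pairDist_of_single_class hs hb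
    have := lt_card_classSupport (m := 2) hst (fun k hk => by
      interval_cases k
      · rw [h0, Pi.zero_apply]
      · exact classMoment_eq_zero_of_single_class hb h1) ha
    omega
  · have := card_support_eq s c a
    have := one_lt_card_classSupport hst h0 ha1
    have := one_lt_card_classSupport hst h0 ha2
    have := card_support_le_two_mul hs (classSupport_eq_empty.1 ha)
    omega
  · have := card_support_eq s c 0
    have := one_lt_card_classSupport hst h0 (h 0)
    have := one_lt_card_classSupport hst h0 (h (0 + 1))
    have := one_lt_card_classSupport hst h0 (h (0 + 2))
    omega

theorem four_le_card_of_single_class (hst : ∀ i j, s i = s j → t i = t j → i = j)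
    {c : Fin n → F} {a : ZMod 3} (ha : classSupport s c a ≠ ∅)
    (hb : ∀ b ≠ a, classSupport s c b = ∅) (h0 : classMoment s t 0 c = 0)
    (h1 : moment s t 1 1 c = 0) (h2 : moment s t 1 2 c = 0) :
    3 < (classSupport s c a).card := by
  refine lt_card_classSupport hst (fun k hk => ?_) ha
  interval_cases k
  · rw [h0, Pi.zero_apply]
  · exact classMoment_eq_zero_of_single_class hb h1
  · exact classMoment_eq_zero_of_single_class hb h2

/-- The class sums make the second run the negative of the first, the first moment makes each run of
the form `(x, -x)`, and the second moment is then `-2 (t h - t k) x`. -/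
theorem eq_zero_of_two_double_runs (hs : ∀ i, s (finRotate n i) = s i + 1)
    (ht : ∀ i, t (finRotate n i) = t i + 1) (hst : ∀ i j, s i = s j → t i = t j → i = j)
    (h2F : (2 : F) ≠ 0) {c : Fin n → F} {a : ZMod 3} (ha : ∀ i, s i = a → c i = 0)
    (h0 : classMoment s t 0 c = 0)
    (h1 : moment s t 1 1 c = 0) (h2 : moment s t 1 2 c = 0) (hS : (support c).card = 4)
    (hR : (runHeads c).card = 2) : False := by
  obtain ⟨h, k, hh, hk, hne, hch, hsum⟩ := support_eq_of_missing_class hs ha hS hR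
  have e0 := congrFun h0 (a + 1)
  have e0' := congrFun h0 (a + 1 + 1)
  have hf : ∀ (w : ZMod 3 → F) (m : ℕ) (i : Fin n), c i = 0 → w (s i) * t i ^ m * c i = 0 :=
    fun w m i hi => by rw [hi, mul_zero]
  rw [classMoment_apply, hsum _ (hf _ _)] at e0 e0'
  rw [moment_apply, hsum _ (hf _ _)] at h1 h2
  have d1 : a + 1 + 1 ≠ a + 1 := (by decide : ∀ b : ZMod 3, b + 1 + 1 ≠ b + 1) a
  simp only [hs, ht, hh, hk, Pi.single_eq_same, Pi.single_eq_of_ne d1, Pi.single_eq_of_ne d1.symm,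
    Pi.zero_apply, Pi.one_apply, pow_zero, one_mul, mul_one, zero_mul, add_zero, zero_add]
    at e0 e0' h1 h2
  have htne : t h - t k ≠ 0 := sub_ne_zero.2 fun h' => hne (hst _ _ (hh.trans hk.symm) h')
  generalize c (finRotate n h) = x1 at *
  generalize c (finRotate n (finRotate n h)) = x2 at *
  generalize c (finRotate n k) = x3 at *
  generalize c (finRotate n (finRotate n k)) = x4 at *
  obtain rfl : x3 = -x1 := by linear_combination e0
  obtain rfl : x4 = -x2 := by linear_combination e0'
  have e1 : (t h - t k) * (x1 + x2) = 0 := by linear_combination h1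
  have e2 := (mul_eq_zero.1 e1).resolve_left htne
  obtain rfl : x2 = -x1 := by linear_combination e2
  have e3 : 2 * (t h - t k) * x1 = 0 := by linear_combination -h2
  exact hch ((mul_eq_zero.1 e3).resolve_left (mul_ne_zero h2F htne))

theorem seven_le_pairDist (hn : 7 ≤ n) (hs : ∀ i, s (finRotate n i) = s i + 1)
    (ht : ∀ i, t (finRotate n i) = t i + 1) (hst : ∀ i j, s i = s j → t i = t j → i = j)
    (h2F : (2 : F) ≠ 0) {c : Fin n → F} (hc : c ≠ 0) (h0 : classMoment s t 0 c = 0)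
    (h1 : moment s t 1 1 c = 0) (h2 : moment s t 1 2 c = 0) : 7 ≤ pairDist c 0 := by
  have hd := pairDist_zero_eq c
  rcases classSupport_cases s hc with ⟨a, ha, hb⟩ | ⟨a, ha, ha1, ha2⟩ | h
  · have := two_mul_le_pairDist_of_single_class hs hb
    have := four_le_card_of_single_class hst ha hb h0 h1 h2
    omega
  · have := card_support_eq s c a
    have := one_lt_card_classSupport hst h0 ha1
    have := one_lt_card_classSupport hst h0 ha2
    have := card_support_le_two_mul hs (classSupport_eq_empty.1 ha)
    -- Weight at least 4 in runs of length at most 2: pair weight below 7 leaves only weight 4 with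
    -- two runs.
    by_contra hlt
    exact eq_zero_of_two_double_runs hs ht hst h2F (classSupport_eq_empty.1 ha) h0 h1 h2
      (by omega) (by omega)
  · have := card_support_eq s c 0
    have := one_lt_card_classSupport hst h0 (h 0)
    have := one_lt_card_classSupport hst h0 (h (0 + 1))
    have := one_lt_card_classSupport hst h0 (h (0 + 2))
    exact pairDist_zero_ge hc hn (by omega)

/-- The two remaining class moments satisfy two linear equations with determinant `w (a + 1) * (r -
1)`. -/
theorem classMoment_one_eq_zero_of_missing_class {w : ZMod 3 → F} {r : F} (hr : r ≠ 1)
    (hw : ∀ a, w (a + 1) = r * w a) (hw0 : ∀ a, w a ≠ 0) {c : Fin n → F} {a : ZMod 3}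
    (ha : classSupport s c a = ∅) {k : ℕ} (h1 : moment s t 1 k c = 0)
    (h1w : moment s t w k c = 0) :
    classMoment s t k c (a + 1) = 0 ∧ classMoment s t k c (a + 2) = 0 := by
  rw [moment_eq_sum_classMoment, sum_zmod_three _ a,
    classMoment_eq_zero (classSupport_eq_empty.1 ha)] at h1 h1w
  rw [show a + 2 = a + 1 + 1 by ring] at *
  rw [hw (a + 1)] at h1w
  simp only [Pi.one_apply] at h1
  have e1 : w (a + 1) * (r - 1) * classMoment s t k c (a + 1 + 1) = 0 := by
    linear_combination h1w - w (a + 1) * h1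
  have e2 := (mul_eq_zero.1 e1).resolve_left (mul_ne_zero (hw0 _) (sub_ne_zero.2 hr))
  exact ⟨by linear_combination h1 - e2, e2⟩

/-- Up to a shift the word is `(1 - x ^ 3) g(x)` with `g = c0 + c1 x + c2 x ^ 2`. The first moments
give `g(1) = g(r) = 0` and the second gives `g'(1) = 0`; a quadratic with a double root at 1 and a
further root `r ≠ 1` is zero. -/
theorem eq_zero_of_single_run_six (hn : 6 ≤ n) (hs : ∀ i, s (finRotate n i) = s i + 1)
    (ht : ∀ i, t (finRotate n i) = t i + 1) (h2F : (2 : F) ≠ 0) (h3F : (3 : F) ≠ 0)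
    {w : ZMod 3 → F} {r : F} (hr : r ≠ 1)
    (hw : ∀ a, w (a + 1) = r * w a) (hw0 : ∀ a, w a ≠ 0) {c : Fin n → F}
    (h0 : classMoment s t 0 c = 0) (h1 : moment s t 1 1 c = 0) (h1w : moment s t w 1 c = 0)
    (h2 : moment s t 1 2 c = 0) (hS : (support c).card = 6)
    (hR : (runHeads c).card = 1) : False := by
  obtain ⟨h, hh⟩ := card_eq_one.1 hR
  have hch := (mem_runHeads.1 (hh ▸ mem_singleton_self h : h ∈ runHeads c)).2
  have hsum := fun (f : Fin n → F) (hf : ∀ i, c i = 0 → f i = 0) =>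
    sum_eq_of_runHeads_eq_singleton hh (hS.trans_le hn) f hf
  rw [hS] at hsum
  have hf : ∀ (w : ZMod 3 → F) (m : ℕ) (i : Fin n), c i = 0 → w (s i) * t i ^ m * c i = 0 :=
    fun w m i hi => by rw [hi, mul_zero]
  generalize finRotate n h = x at *
  -- Three steps return to the same class, so `w` forces `r` to be a cube root of unity.
  have hr3 : r ^ 3 = 1 := by
    have e : r ^ 3 * w 0 = 1 * w 0 := by
      have h3 : (0 : ZMod 3) + 1 + 1 + 1 = 0 := by decide
      calc r ^ 3 * w 0 = w (0 + 1 + 1 + 1) := by simp only [hw]; ring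
        _ = 1 * w 0 := by rw [h3, one_mul]
    exact mul_right_cancel₀ (hw0 0) e
  have e0 := congrFun h0 (s x)
  have e1 := congrFun h0 (s x + 1)
  have e2 := congrFun h0 (s x + 1 + 1)
  rw [classMoment_apply, hsum _ (hf _ _)] at e0 e1 e2
  rw [moment_apply, hsum _ (hf _ _)] at h1 h1w h2
  have hwx := hw0 (s x)
  have d3 : s x + 1 + 1 + 1 = s x := by generalize s x = a; revert a; decide
  have d1 : s x + 1 ≠ s x := by generalize s x = a; revert a; decide
  have d2 : s x + 1 + 1 ≠ s x := by generalize s x = a; revert a; decide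
  have d12 : s x + 1 + 1 ≠ s x + 1 := by generalize s x = a; revert a; decide
  simp only [sum_range_succ, sum_range_zero, Function.iterate_succ_apply', Function.iterate_zero,
    id, hs, ht, d3, Pi.single_eq_same, Pi.single_eq_of_ne d1, Pi.single_eq_of_ne d1.symm,
    Pi.single_eq_of_ne d2, Pi.single_eq_of_ne d2.symm, Pi.single_eq_of_ne d12,
    Pi.single_eq_of_ne d12.symm, Pi.zero_apply, Pi.one_apply, pow_zero, pow_one, one_mul, mul_one,
    zero_mul, add_zero, zero_add, hw] at e0 e1 e2 h1 h1w h2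
  generalize c (finRotate n (finRotate n (finRotate n (finRotate n (finRotate n x))))) = c5 at *
  generalize c (finRotate n (finRotate n (finRotate n (finRotate n x)))) = c4 at *
  generalize c (finRotate n (finRotate n (finRotate n x))) = c3 at *
  generalize c (finRotate n (finRotate n x)) = c2 at *
  generalize c (finRotate n x) = c1 at *
  generalize c x = c0 at *
  obtain rfl : c3 = -c0 := by linear_combination e0
  obtain rfl : c4 = -c1 := by linear_combination e1
  obtain rfl : c5 = -c2 := by linear_combination e2
  have f1 : 3 * (c0 + c1 + c2) = 0 := by linear_combination -h1
  have g1 := (mul_eq_zero.1 f1).resolve_left h3F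
  have f2 : 3 * w (s x) * (c0 + r * c1 + r ^ 2 * c2) = 0 := by linear_combination -h1w
  have g2 := (mul_eq_zero.1 f2).resolve_left (mul_ne_zero h3F hwx)
  have f3 : 2 * 3 * (c1 + 2 * c2) = 0 := by
    linear_combination -h2 - (6 * t x + 9) * g1
  have g3 := (mul_eq_zero.1 f3).resolve_left (mul_ne_zero h2F h3F)
  have f4 : (r - 1) * (r - 1) * c2 = 0 := by linear_combination g2 - g1 + (1 - r) * g3
  have hr1 := sub_ne_zero.2 hr
  have g4 := (mul_eq_zero.1 f4).resolve_left (mul_ne_zero hr1 hr1)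
  exact hch (by linear_combination g1 - g3 + g4)

theorem eight_le_pairDist (hn : 8 ≤ n) (hs : ∀ i, s (finRotate n i) = s i + 1)
    (ht : ∀ i, t (finRotate n i) = t i + 1) (hst : ∀ i j, s i = s j → t i = t j → i = j)
    (h2F : (2 : F) ≠ 0) (h3F : (3 : F) ≠ 0) {w : ZMod 3 → F} {r : F} (hr : r ≠ 1)
    (hw : ∀ a, w (a + 1) = r * w a) (hw0 : ∀ a, w a ≠ 0) {c : Fin n → F} (hc : c ≠ 0)
    (h0 : classMoment s t 0 c = 0) (h1 : moment s t 1 1 c = 0) (h1w : moment s t w 1 c = 0)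
    (h2 : moment s t 1 2 c = 0) : 8 ≤ pairDist c 0 := by
  have hd := pairDist_zero_eq c
  rcases classSupport_cases s hc with ⟨a, ha, hb⟩ | ⟨a, ha, ha1, ha2⟩ | h
  · have := two_mul_le_pairDist_of_single_class hs hb
    have := four_le_card_of_single_class hst ha hb h0 h1 h2
    omega
  · obtain ⟨m1, m2⟩ := classMoment_one_eq_zero_of_missing_class hr hw hw0 ha h1 h1w
    have := card_support_eq s c a
    have := lt_card_classSupport (m := 2) hst (fun k hk => by
      interval_cases k
      · rw [h0, Pi.zero_apply]
      · exact m1) ha1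
    have := lt_card_classSupport (m := 2) hst (fun k hk => by
      interval_cases k
      · rw [h0, Pi.zero_apply]
      · exact m2) ha2
    have := card_support_le_two_mul hs (classSupport_eq_empty.1 ha)
    omega
  · have := card_support_eq s c 0
    have := one_lt_card_classSupport hst h0 (h 0)
    have := one_lt_card_classSupport hst h0 (h (0 + 1))
    have := one_lt_card_classSupport hst h0 (h (0 + 2))
    -- With all three classes met the weight is at least 6; pair weight 7 is possible only as six
    -- consecutive entries.
    by_cases h7 : 7 ≤ (support c).card
    · exact pairDist_zero_ge hc hn (by omega)
    · have := pairDist_zero_ge hc (m := 7) (by omega) (by omega)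
      by_contra hlt
      exact eq_zero_of_single_run_six (by omega) hs ht h2F h3F hr hw hw0 h0 h1 h1w h2
        (by omega) (by omega)

end Distance

/-! ### The repeated-root codes of length `3p`. -/

section Codes

variable (p : ℕ) [Fact p.Prime]

theorem cast_val_injective (h5 : 5 ≤ p) (i j : Fin (3 * p))
    (hs : (i.val : ZMod 3) = (j.val : ZMod 3)) (ht : (i.val : ZMod p) = (j.val : ZMod p)) :
    i = j := by
  rw [ZMod.natCast_eq_natCast_iff] at hs ht
  have hcop : Nat.Coprime 3 p :=
    (Nat.coprime_primes Nat.prime_three Fact.out).2 (by omega)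
  exact Fin.ext (Nat.ModEq.eq_of_lt_of_lt ((Nat.modEq_and_modEq_iff_modEq_mul hcop).1 ⟨hs, ht⟩)
    i.isLt j.isLt)

theorem isRepeatedRootCyclic_of_le {C : Submodule (ZMod p) (Fin (3 * p) → ZMod p)}
    (h : ∀ c ∈ C, cyclicShift (ZMod p) (3 * p) c ∈ C) : IsRepeatedRootCyclic C := by
  refine ⟨isCyclicCode_of_le h, ?_⟩
  rw [ZMod.ringChar_zmod_n, Nat.coprime_mul_iff_left, Nat.coprime_self]
  exact fun h => (Fact.out : p.Prime).one_lt.ne' h.2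

theorem natCast_ne_zero_of_lt {m : ℕ} (h0 : 0 < m) (hm : m < p) : (m : ZMod p) ≠ 0 := by
  rw [Ne, ZMod.natCast_eq_zero_iff]
  exact Nat.not_dvd_of_pos_of_lt h0 hm

theorem exists_repeatedRoot_isMDS_six (h5 : 5 ≤ p) :
    ∃ C : Submodule (ZMod p) (Fin (3 * p) → ZMod p), IsRepeatedRootCyclic C ∧
      IsMDS p 6 (C : Set (Fin (3 * p) → ZMod p)) := by
  let s : Fin (3 * p) → ZMod 3 := fun i => (i.val : ZMod 3)
  let t : Fin (3 * p) → ZMod p := fun i => (i.val : ZMod p)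
  have hs : ∀ i, s (finRotate _ i) = s i + 1 := cast_finRotate (dvd_mul_right _ _)
  have ht : ∀ i, t (finRotate _ i) = t i + 1 := cast_finRotate (dvd_mul_left _ _)
  have hst : ∀ i j, s i = s j → t i = t j → i = j := cast_val_injective p h5
  let L := (classMoment s t 0).prod (moment s t 1 1)
  have hL : ∀ c, L c = 0 ↔ classMoment s t 0 c = 0 ∧ moment s t 1 1 c = 0 := fun c => by
    simp [L, Prod.ext_iff]
  refine ⟨LinearMap.ker L, isRepeatedRootCyclic_of_le p fun c hc => ?_, ?_⟩
  · rw [LinearMap.mem_ker, hL] at hc ⊢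
    exact ⟨classMoment_zero_cyclicShift hs ht hc.1,
      moment_one_cyclicShift (r := 1) hs ht (by simp) hc.1 hc.2⟩
  · have := isMDS_ker (r := 4) (by simp) (by omega) L fun c hc hc0 =>
      six_le_pairDist hs hst hc0 ((hL c).1 hc).1 ((hL c).1 hc).2
    rwa [ZMod.card] at this

theorem exists_repeatedRoot_isMDS_seven (h5 : 5 ≤ p) :
    ∃ C : Submodule (ZMod p) (Fin (3 * p) → ZMod p), IsRepeatedRootCyclic C ∧
      IsMDS p 7 (C : Set (Fin (3 * p) → ZMod p)) := by
  let s : Fin (3 * p) → ZMod 3 := fun i => (i.val : ZMod 3)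
  let t : Fin (3 * p) → ZMod p := fun i => (i.val : ZMod p)
  have hs : ∀ i, s (finRotate _ i) = s i + 1 := cast_finRotate (dvd_mul_right _ _)
  have ht : ∀ i, t (finRotate _ i) = t i + 1 := cast_finRotate (dvd_mul_left _ _)
  have hst : ∀ i j, s i = s j → t i = t j → i = j := cast_val_injective p h5
  have h2 : (2 : ZMod p) ≠ 0 := by
    exact_mod_cast natCast_ne_zero_of_lt p (m := 2) two_pos (by omega)
  let L := (classMoment s t 0).prod ((moment s t 1 1).prod (moment s t 1 2))
  have hL : ∀ c, L c = 0 ↔ classMoment s t 0 c = 0 ∧ moment s t 1 1 c = 0 ∧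
      moment s t 1 2 c = 0 := fun c => by
    simp [L, Prod.ext_iff]
  refine ⟨LinearMap.ker L, isRepeatedRootCyclic_of_le p fun c hc => ?_, ?_⟩
  · rw [LinearMap.mem_ker, hL] at hc ⊢
    obtain ⟨h0, h1, h2⟩ := hc
    exact ⟨classMoment_zero_cyclicShift hs ht h0,
      moment_one_cyclicShift (r := 1) hs ht (by simp) h0 h1,
      moment_two_cyclicShift hs ht h0 h1 h2⟩
  · have := isMDS_ker (r := 5) (by simp) (by omega) L fun c hc hc0 => by
      obtain ⟨m0, m1, m2⟩ := (hL c).1 hc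
      exact seven_le_pairDist (by omega) hs ht hst h2 hc0 m0 m1 m2
    rwa [ZMod.card] at this

theorem exists_repeatedRoot_isMDS_eight (h3 : 3 ∣ p - 1) :
    ∃ C : Submodule (ZMod p) (Fin (3 * p) → ZMod p), IsRepeatedRootCyclic C ∧
      IsMDS p 8 (C : Set (Fin (3 * p) → ZMod p)) := by
  have h5 : 5 ≤ p := by
    have := (Fact.out : p.Prime).two_le
    by_contra hlt
    interval_cases p
    · omega
    · omega
    · exact absurd (Fact.out : Nat.Prime 4) (by norm_num)
  let s : Fin (3 * p) → ZMod 3 := fun i => (i.val : ZMod 3)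
  let t : Fin (3 * p) → ZMod p := fun i => (i.val : ZMod p)
  have hs : ∀ i, s (finRotate _ i) = s i + 1 := cast_finRotate (dvd_mul_right _ _)
  have ht : ∀ i, t (finRotate _ i) = t i + 1 := cast_finRotate (dvd_mul_left _ _)
  have hst : ∀ i j, s i = s j → t i = t j → i = j := cast_val_injective p h5
  have h2F : (2 : ZMod p) ≠ 0 := by
    exact_mod_cast natCast_ne_zero_of_lt p (m := 2) two_pos (by omega)
  have h3F : (3 : ZMod p) ≠ 0 := by
    exact_mod_cast natCast_ne_zero_of_lt p (m := 3) three_pos (by omega)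
  obtain ⟨u, hu⟩ := IsCyclic.exists_ofOrder_eq_natCard (α := (ZMod p)ˣ)
  rw [Nat.card_eq_fintype_card, ZMod.card_units] at hu
  obtain ⟨m, hm⟩ := h3
  -- `p - 1 = 3 * m`, so the `m`-th power of a generator of the unit group has order 3.
  have hprim : IsPrimitiveRoot ((u : ZMod p) ^ m) 3 := by
    refine IsPrimitiveRoot.pow (n := p - 1) (by omega) ?_ (by rw [hm, mul_comm])
    rw [← hu, ← orderOf_units]
    exact IsPrimitiveRoot.orderOf _
  generalize (u : ZMod p) ^ m = r at hprim
  have hr : r ≠ 1 := hprim.ne_one (by norm_num)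
  have hr3 : r ^ 3 = 1 := hprim.pow_eq_one
  have hr0 : r ≠ 0 := hprim.ne_zero (by norm_num)
  -- With this weight the first moment is `r` times the derivative of the code polynomial at `r`.
  let w : ZMod 3 → ZMod p := fun a => r ^ a.val
  have hw0 : ∀ a, w a ≠ 0 := fun a => pow_ne_zero _ hr0
  have hw : ∀ a, w (a + 1) = r * w a := fun a => by
    change r ^ (a + 1).val = r * r ^ a.val
    rw [← pow_succ', ZMod.val_add, show (1 : ZMod 3).val = 1 from rfl,
      ← pow_eq_pow_mod _ hr3]
  let L := (classMoment s t 0).prod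
    ((moment s t 1 1).prod ((moment s t w 1).prod (moment s t 1 2)))
  have hL : ∀ c, L c = 0 ↔ classMoment s t 0 c = 0 ∧ moment s t 1 1 c = 0 ∧
      moment s t w 1 c = 0 ∧ moment s t 1 2 c = 0 := fun c => by
    simp [L, Prod.ext_iff]
  refine ⟨LinearMap.ker L, isRepeatedRootCyclic_of_le p fun c hc => ?_, ?_⟩
  · rw [LinearMap.mem_ker, hL] at hc ⊢
    obtain ⟨h0, h1, h1w, h2⟩ := hc
    exact ⟨classMoment_zero_cyclicShift hs ht h0,
      moment_one_cyclicShift (r := 1) hs ht (by simp) h0 h1,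
      moment_one_cyclicShift hs ht hw h0 h1w,
      moment_two_cyclicShift hs ht h0 h1 h2⟩
  · have := isMDS_ker (r := 6) (by simp) (by omega) L fun c hc hc0 => by
      obtain ⟨m0, m1, m1w, m2⟩ := (hL c).1 hc
      exact eight_le_pairDist (by omega) hs ht hst h2F h3F hr hw hw0 hc0 m0 m1 m1w m2
    rwa [ZMod.card] at this

end Codes

/-! ### Simple-root codes through evaluation at roots of unity. -/

section SimpleRoot

variable {F K : Type*} [Field F] [Field K] [Algebra F K] {n : ℕ}

/-- The evaluation `c ↦ ∑ i, c i * a ^ i` of a word at `a`. -/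
def evalAt (n : ℕ) (a : K) : (Fin n → F) →ₗ[F] K :=
  ∑ i : Fin n, (LinearMap.toSpanSingleton F K (a ^ i.val)) ∘ₗ LinearMap.proj i

theorem evalAt_apply (a : K) (c : Fin n → F) :
    evalAt n a c = ∑ i : Fin n, algebraMap F K (c i) * a ^ i.val := by
  simp [evalAt, Algebra.smul_def]

theorem pow_val_finRotate {a : K} (ha : a ^ n = 1) (i : Fin n) :
    a ^ (finRotate n i).val = a ^ i.val * a := by
  rw [val_finRotate, ← pow_eq_pow_mod _ ha, pow_succ]

theorem pow_val_finRotate_iterate {a : K} (ha : a ^ n = 1) (i : Fin n) (k : ℕ) :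
    a ^ ((finRotate n)^[k] i).val = a ^ i.val * a ^ k := by
  rw [val_finRotate_iterate, ← pow_eq_pow_mod _ ha, pow_add]

theorem evalAt_cyclicShift {a : K} (ha : a ^ n = 1) {c : Fin n → F} (h : evalAt n a c = 0) :
    evalAt n a (cyclicShift F n c) = 0 := by
  rw [evalAt_apply] at h ⊢
  rw [sum_cyclicShift c fun x i => algebraMap F K x * a ^ i.val, ← zero_mul a, ← h, sum_mul]
  exact sum_congr rfl fun i _ => by rw [pow_val_finRotate ha]; ring

/-- The coefficients lie in `F`, hence are fixed by the Frobenius of `K` over `F`, so zeros come in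
conjugates. -/
theorem evalAt_frobenius [Fintype F] (a : K) {c : Fin n → F} (h : evalAt n a c = 0) :
    evalAt n (a ^ Fintype.card F) c = 0 := by
  have := congrArg (FiniteField.frobeniusAlgHom F K) h
  rw [evalAt_apply, map_sum, map_zero] at this
  rw [evalAt_apply, ← this]
  refine sum_congr rfl fun i _ => ?_
  rw [map_mul, AlgHom.commutes, FiniteField.frobeniusAlgHom_apply, ← pow_mul, ← pow_mul,
    mul_comm i.val]

variable [DecidableEq F]

/-- The Hartmann–Tzeng bound for the zeros `1, a, b, a * b`, where `a` and `b` are both of order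
the length. -/
theorem four_le_card_support (hn : 3 ≤ n) {a b : K} (ha : IsPrimitiveRoot a n) (hb : IsPrimitiveRoot b n)
    {c : Fin n → F} (hc : c ≠ 0) (h1 : evalAt n (1 : K) c = 0) (h2 : evalAt n a c = 0)
    (h3 : evalAt n b c = 0) (h4 : evalAt n (a * b) c = 0) : 4 ≤ (support c).card := by
  by_contra hlt
  obtain ⟨x, hx⟩ := support_nonempty hc
  have hy : ∃ y z : Fin n, y ≠ x ∧ z ≠ x ∧ ∀ i, i ≠ x → c i ≠ 0 → i = y ∨ i = z := by
    -- The rest of the support, of size at most 2, is padded to exactly two positions, neither equal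
    -- to `x`.
    obtain ⟨u, hu1, hu2, hu⟩ := exists_subsuperset_card_eq (n := 2)
      (erase_subset_erase x (subset_univ (support c)))
      (by rw [card_erase_of_mem hx]; omega)
      (by rw [card_erase_of_mem (mem_univ x), card_univ, Fintype.card_fin]; omega)
    obtain ⟨y, z, -, rfl⟩ := card_eq_two.1 hu
    refine ⟨y, z, (mem_erase.1 (hu2 (by simp))).1, (mem_erase.1 (hu2 (by simp))).1,
      fun i hix hci => ?_⟩
    simpa using hu1 (mem_erase.2 ⟨hix, mem_support.2 hci⟩)
  obtain ⟨y, z, hyx, hzx, hyz⟩ := hy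
  simp only [evalAt_apply] at h1 h2 h3 h4
  -- The product kills the terms at `y` and `z`, leaving only `x`; expanded, it combines the
  -- evaluations at `a * b`, `a`, `b` and `1`.
  have key : ∑ i : Fin n, algebraMap F K (c i) *
      ((a ^ i.val - a ^ y.val) * (b ^ i.val - b ^ z.val)) = 0 := by
    calc _ = (∑ i : Fin n, algebraMap F K (c i) * (a * b) ^ i.val)
          - b ^ z.val * (∑ i : Fin n, algebraMap F K (c i) * a ^ i.val)
          - a ^ y.val * (∑ i : Fin n, algebraMap F K (c i) * b ^ i.val)
          + a ^ y.val * b ^ z.val * (∑ i : Fin n, algebraMap F K (c i) * 1 ^ i.val) := by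
          simp only [mul_sum, ← sum_sub_distrib, ← sum_add_distrib]
          exact sum_congr rfl fun i _ => by rw [mul_pow, one_pow]; ring
      _ = 0 := by rw [h1, h2, h3, h4]; ring
  rw [sum_eq_single x] at key
  · have hax : a ^ x.val - a ^ y.val ≠ 0 := sub_ne_zero.2 fun h =>
      hyx (Fin.ext (ha.pow_inj y.isLt x.isLt h.symm))
    have hbx : b ^ x.val - b ^ z.val ≠ 0 := sub_ne_zero.2 fun h =>
      hzx (Fin.ext (hb.pow_inj z.isLt x.isLt h.symm))
    have := (mul_eq_zero.1 key).resolve_right (mul_ne_zero hax hbx)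
    exact mem_support.1 hx ((map_eq_zero _).1 this)
  · intro i _ hix
    by_cases hci : c i = 0
    · simp [hci]
    · rcases hyz i hix hci with rfl | rfl <;> simp
  · simp

/-- Only weight 4 in a single run needs excluding: four consecutive entries annihilated at the four
distinct points `1, a, b, a * b` form a Vandermonde system. -/
theorem six_le_pairDist_of_evalAt (hn : 6 ≤ n) {a b : K} (ha : IsPrimitiveRoot a n)
    (hb : IsPrimitiveRoot b n) (hab : a ≠ b) (hab1 : a * b ≠ 1)
    {c : Fin n → F} (hc : c ≠ 0) (h1 : evalAt n (1 : K) c = 0) (h2 : evalAt n a c = 0)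
    (h3 : evalAt n b c = 0) (h4 : evalAt n (a * b) c = 0) : 6 ≤ pairDist c 0 := by
  have hw := four_le_card_support (by omega) ha hb hc h1 h2 h3 h4
  by_cases h5 : 5 ≤ (support c).card
  · exact pairDist_zero_ge hc hn (by omega)
  have hge := pairDist_zero_ge hc (m := 5) (by omega) (by omega)
  by_contra hlt
  rw [pairDist_zero_eq] at hge hlt
  have hS : (support c).card = 4 := by omega
  obtain ⟨h, hh⟩ := card_eq_one.1 (show (runHeads c).card = 1 by omega)
  have hch := (mem_runHeads.1 (hh ▸ mem_singleton_self h : h ∈ runHeads c)).2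
  have ha1 : a ≠ 1 := ha.ne_one (by omega)
  have hb1 : b ≠ 1 := hb.ne_one (by omega)
  have ha0 : a ≠ 0 := ha.ne_zero (by omega)
  have hb0 : b ≠ 0 := hb.ne_zero (by omega)
  have hev : ∀ e : K, e ^ n = 1 → evalAt n e c = 0 → ∑ k : Fin 4,
      e ^ (k : ℕ) * algebraMap F K (c ((finRotate n)^[k] (finRotate n h))) = 0 := by
    intro e he hec
    have he0 : e ≠ 0 := by
      rintro rfl
      rw [zero_pow (by omega)] at he
      exact zero_ne_one he
    rw [evalAt_apply, sum_eq_of_runHeads_eq_singleton hh (by omega) _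
      (fun i hi => by rw [hi, map_zero, zero_mul]), hS] at hec
    rw [Fin.sum_univ_eq_sum_range
      (fun k => e ^ k * algebraMap F K (c ((finRotate n)^[k] (finRotate n h))))]
    refine (mul_eq_zero.1 ?_).resolve_left (pow_ne_zero (finRotate n h).val he0)
    rw [← hec, mul_sum]
    exact sum_congr rfl fun k _ => by rw [pow_val_finRotate_iterate he]; ring
  have hinj : Function.Injective ![1, a, b, a * b] := by
    have e1 : a ≠ a * b := fun h => hb1 (mul_left_cancel₀ ha0 (by rw [mul_one]; exact h.symm))
    have e2 : b ≠ a * b := fun h => ha1 (mul_right_cancel₀ hb0 (by rw [one_mul]; exact h.symm))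
    intro i j hij
    fin_cases i <;> fin_cases j <;> simp_all [eq_comm]
  have hz := Matrix.eq_zero_of_forall_index_sum_pow_mul_eq_zero
    (v := fun k : Fin 4 => algebraMap F K (c ((finRotate n)^[k] (finRotate n h)))) hinj
    (by
      intro j
      fin_cases j
      · exact hev 1 (one_pow n) h1
      · exact hev a ha.pow_eq_one h2
      · exact hev b hb.pow_eq_one h3
      · exact hev (a * b) (by rw [mul_pow, ha.pow_eq_one, hb.pow_eq_one, one_mul]) h4)
  exact hch ((map_eq_zero (algebraMap F K)).1 (congrFun hz 0))

end SimpleRoot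

/-- A linear code of codimension at most `4` and length at least `q + 4` is not MDS. -/
theorem exists_card_support_le_four {F : Type*} [Field F] [DecidableEq F] [Fintype F] {n : ℕ}
    {W : Type*} [AddCommGroup W] [Module F W] [FiniteDimensional F W]
    (hW : Module.finrank F W ≤ 4) (hn : Fintype.card F + 4 ≤ n) (L : (Fin n → F) →ₗ[F] W) :
    ∃ c ≠ 0, L c = 0 ∧ (support c).card ≤ 4 := by
  by_contra! hcon
  have hq := Fintype.one_lt_card (α := F)
  let B : Finset (Fin n) := univ.filter fun i => i.val < 4
  have hB : B.card = 4 := by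
    rw [Fin.card_filter_val_lt]
    omega
  let x : Fin n := ⟨2, by omega⟩
  let y : Fin n := ⟨3, by omega⟩
  have hx : x ∈ B := by simp [B, x]
  have hy : y ∈ B := by simp [B, y]
  have hxy : x ≠ y := by simp [x, y]
  have hex : ∀ i : Fin n, ∃ c : Fin n → F, i ∉ B →
      L c = 0 ∧ (∀ j ∉ insert i B, c j = 0) ∧ ∀ j ∈ insert i B, c j ≠ 0 := by
    intro i
    by_cases hi : i ∈ B
    · exact ⟨0, fun h => absurd hi h⟩
    have hcard : (insert i B).card = 5 := by rw [card_insert_of_notMem hi, hB]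
    obtain ⟨c, hc, hLc, hs⟩ := exists_mem_ker_supported L (insert i B) (by omega)
    refine ⟨c, fun _ => ⟨hLc, hs, fun j hj hcj => ?_⟩⟩
    have hsub : support c ⊆ (insert i B).erase j := by
      intro k hk
      rw [mem_support] at hk
      refine mem_erase.2 ⟨fun h => hk (h ▸ hcj), ?_⟩
      by_contra hk'
      exact hk (hs k hk')
    have h1 := card_le_card hsub
    rw [card_erase_of_mem hj] at h1
    have := hcon c hc hLc
    omega
  choose w hw using hex
  -- At least `q` positions lie outside `B` but there are only `q - 1` nonzero ratios. Two words
  -- with equal ratio combine to cancel at both `x` and `y`, leaving at most `6 - 2` positions.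
  have hmap : ∀ i ∈ Bᶜ, w i x / w i y ∈ (univ : Finset F).erase 0 := by
    intro i hi
    obtain ⟨-, -, h⟩ := hw i (mem_compl.1 hi)
    exact mem_erase.2 ⟨div_ne_zero (h x (mem_insert_of_mem hx)) (h y (mem_insert_of_mem hy)),
      mem_univ _⟩
  obtain ⟨i, hi, j, hj, hij, he⟩ := exists_ne_map_eq_of_card_lt_of_maps_to (by
    rw [card_erase_of_mem (mem_univ _), card_compl, hB, Fintype.card_fin, card_univ]
    omega) hmap
  rw [mem_compl] at hi hj
  obtain ⟨hLi, hi0, hi1⟩ := hw i hi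
  obtain ⟨hLj, hj0, hj1⟩ := hw j hj
  rw [div_eq_div_iff (hi1 y (mem_insert_of_mem hy)) (hj1 y (mem_insert_of_mem hy))] at he
  let c := w j y • w i - w i y • w j
  have hsub : support c ⊆ ((insert i (insert j B)).erase x).erase y := by
    intro k hk
    rw [mem_support] at hk
    refine mem_erase.2 ⟨?_, mem_erase.2 ⟨?_, ?_⟩⟩
    · rintro rfl
      exact hk (by simp [c]; ring)
    · rintro rfl
      exact hk (by simp only [c, Pi.sub_apply, Pi.smul_apply, smul_eq_mul]; linear_combination he)
    · by_contra hkn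
      simp only [mem_insert, not_or] at hkn
      refine hk ?_
      simp [c, hi0 k (by simp [hkn]), hj0 k (by simp [hkn])]
  have hcard : (((insert i (insert j B)).erase x).erase y).card = 4 := by
    rw [card_erase_of_mem (mem_erase.2 ⟨hxy.symm, by simp [hy]⟩), card_erase_of_mem (by simp [hx]),
      card_insert_of_notMem (by simp [hij, hi]), card_insert_of_notMem hj, hB]
  have hci : c i ≠ 0 := by
    have h0 : w j i = 0 := hj0 i (by simp [hij, hi])
    simp only [c, Pi.sub_apply, Pi.smul_apply, smul_eq_mul, h0, mul_zero, sub_zero]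
    exact mul_ne_zero (hj1 y (mem_insert_of_mem hy)) (hi1 i (mem_insert_self _ _))
  have h1 := hcon c (fun h => hci (by rw [h]; rfl)) (by simp [c, hLi, hLj])
  have h2 := card_le_card hsub
  omega

theorem exists_simpleRoot_isMDS_six {F : Type*} [Field F] [Fintype F] [DecidableEq F] {n : ℕ}
    (hn : Fintype.card F + 4 ≤ n) (hdvd : n ∣ Fintype.card F ^ 2 - 1) :
    ∃ C : Submodule F (Fin n → F), IsSimpleRootCyclic C ∧ IsAlmostMDS C ∧
      IsMDS (Fintype.card F) 6 (C : Set (Fin n → F)) := by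
  set q := Fintype.card F with hq
  have hq1 : 1 < q := Fintype.one_lt_card
  obtain ⟨p, hp⟩ := CharP.exists F
  have hpp : p.Prime := CharP.char_is_prime F p
  have := Fact.mk hpp
  let K := FiniteField.Extension F p 2
  have hfin : Module.finrank F K = 2 := FiniteField.finrank_extension F p 2
  have hK : Nat.card K = q ^ 2 := by
    rw [FiniteField.natCard_extension, Nat.card_eq_fintype_card]
  have hcop : n.Coprime (ringChar F) := by
    rw [ringChar.eq F p]
    have hpq : p ∣ q := by
      rw [← CharP.cast_eq_zero_iff F p, hq]
      exact FiniteField.cast_card_eq_zero F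
    refine (Nat.Coprime.symm ((Nat.Prime.coprime_iff_not_dvd hpp).2 fun h => ?_))
    have h1 : p ∣ q ^ 2 := dvd_pow hpq two_ne_zero
    have h2 := (Nat.dvd_sub_iff_right (Nat.one_le_pow _ _ (by omega)) h1).1 (h.trans hdvd)
    exact hpp.one_lt.ne' (Nat.dvd_one.1 h2)
  have hq2 : 0 < q ^ 2 - 1 := Nat.sub_pos_of_lt (Nat.one_lt_pow two_ne_zero hq1)
  obtain ⟨a, ha⟩ : ∃ a : K, IsPrimitiveRoot a n := by
    obtain ⟨u, hu⟩ := IsCyclic.exists_ofOrder_eq_natCard (α := Kˣ)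
    rw [Nat.card_units, hK] at hu
    obtain ⟨m, hm⟩ := hdvd
    refine ⟨(u : K) ^ m, IsPrimitiveRoot.pow (n := q ^ 2 - 1) hq2 ?_ (by rw [hm, mul_comm])⟩
    rw [← hu, ← orderOf_units]
    exact IsPrimitiveRoot.orderOf _
  have hnq : n.Coprime q := by
    refine Nat.Coprime.symm (Nat.coprime_of_dvd fun k hk h1 h2 => ?_)
    have h3 := (Nat.dvd_sub_iff_right (Nat.one_le_pow _ _ (by omega))
      (dvd_pow h1 two_ne_zero)).1 (h2.trans hdvd)
    exact hk.one_lt.ne' (Nat.dvd_one.1 h3)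
  have hb : IsPrimitiveRoot (a ^ q) n := ha.pow_of_coprime q hnq.symm
  have hpow : ∀ k, 0 < k → k < n → a ^ k ≠ 1 := fun k => fun h0 hk h =>
    absurd (Nat.le_of_dvd h0 (ha.dvd_of_pow_eq_one k h)) (by omega)
  have hab : a ≠ a ^ q := fun h => by
    refine hpow (q - 1) (by omega) (by omega) ?_
    refine mul_right_cancel₀ (ha.ne_zero (by omega)) ?_
    rw [← pow_succ, Nat.sub_add_cancel hq1.le, one_mul, ← h]
  have hab1 : a * a ^ q ≠ 1 := by
    rw [← pow_succ']
    exact hpow _ (by omega) (by omega)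
  -- `a ^ (q + 1)` is the norm of `a`, so it lies in `F` and its check costs one dimension; the
  -- total is `1 + 1 + 2 = 4`.
  obtain ⟨e, he⟩ : ∃ e : F, algebraMap F K e = a * a ^ q := by
    refine ⟨Algebra.norm F a, ?_⟩
    rw [FiniteField.algebraMap_norm_eq_prod_pow, hfin, Nat.card_eq_fintype_card]
    simp [prod_range_succ, hq]
  have hen : e ^ n = 1 := by
    apply (algebraMap F K).injective
    rw [map_pow, he, map_one, mul_pow, ha.pow_eq_one, hb.pow_eq_one, one_mul]
  let L : (Fin n → F) →ₗ[F] F × F × K := (evalAt n 1).prod ((evalAt n e).prod (evalAt n a))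
  have hL : ∀ c, L c = 0 ↔ evalAt n (1 : F) c = 0 ∧ evalAt n e c = 0 ∧ evalAt n a c = 0 :=
    fun c => by simp [L, Prod.ext_iff]
  have hlift : ∀ (x : F) (c : Fin n → F), evalAt n x c = 0 → evalAt n (algebraMap F K x) c = 0 := by
    intro x c h
    rw [evalAt_apply] at h ⊢
    simpa using congrArg (algebraMap F K) h
  have hev : ∀ c, L c = 0 → evalAt n (1 : K) c = 0 ∧ evalAt n a c = 0 ∧
      evalAt n (a ^ q) c = 0 ∧ evalAt n (a * a ^ q) c = 0 := by
    intro c hc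
    obtain ⟨h1, h2, h3⟩ := (hL c).1 hc
    exact ⟨by simpa using hlift 1 c h1, h3, evalAt_frobenius a h3, he ▸ hlift e c h2⟩
  have hW : Module.finrank F (F × F × K) = 4 := by
    rw [Module.finrank_prod, Module.finrank_prod, Module.finrank_self, hfin]
  have hpair : ∀ c, L c = 0 → c ≠ 0 → 4 + 2 ≤ pairDist c 0 := fun c hc hc0 => by
    obtain ⟨h1, h2, h3, h4⟩ := hev c hc
    exact six_le_pairDist_of_evalAt (by omega) ha hb hab hab1 hc0 h1 h2 h3 h4
  have hham : ∀ c, L c = 0 → c ≠ 0 → 4 ≤ (support c).card := fun c hc hc0 => by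
    obtain ⟨h1, h2, h3, h4⟩ := hev c hc
    exact four_le_card_support (by omega) ha hb hc0 h1 h2 h3 h4
  refine ⟨LinearMap.ker L, ⟨isCyclicCode_of_le fun c hc => ?_, hcop⟩, ⟨n - 4, 4, ⟨?_, ?_, ?_⟩, ?_⟩,
    isMDS_ker hW (by omega) L hpair⟩
  · rw [LinearMap.mem_ker, hL] at hc ⊢
    obtain ⟨h1, h2, h3⟩ := hc
    exact ⟨evalAt_cyclicShift (one_pow n) h1, evalAt_cyclicShift hen h2,
      evalAt_cyclicShift ha.pow_eq_one h3⟩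
  · exact finrank_ker_of_pairDist hW (by omega) L hpair
  · obtain ⟨c, hc0, hc, hle⟩ := exists_card_support_le_four hW.le hn L
    refine ⟨c, hc, 0, Submodule.zero_mem _, hc0, ?_⟩
    rw [hammingDist_eq_card_support, sub_zero]
    exact le_antisymm hle (hham c hc hc0)
  · rintro m ⟨x, hx, y, hy, hxy, rfl⟩
    rw [hammingDist_eq_card_support]
    exact hham _ (Submodule.sub_mem _ hx hy) (sub_ne_zero.2 hxy)
  · omega

end SymbolPair

theorem theorem3 :
    (∀ (p : ℕ) [Fact p.Prime], 5 ≤ p →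
      ∃ C : Submodule (ZMod p) (Fin (3 * p) → ZMod p),
        SymbolPair.IsRepeatedRootCyclic C ∧
        SymbolPair.IsMDS p 7 (C : Set (Fin (3 * p) → ZMod p))) ∧
    (∀ (p : ℕ) [Fact p.Prime], 3 ∣ p - 1 →
      ∃ C : Submodule (ZMod p) (Fin (3 * p) → ZMod p),
        SymbolPair.IsRepeatedRootCyclic C ∧
        SymbolPair.IsMDS p 8 (C : Set (Fin (3 * p) → ZMod p))) ∧
    (∀ (p : ℕ) [Fact p.Prime], 5 ≤ p →
      ∃ C : Submodule (ZMod p) (Fin (3 * p) → ZMod p),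
        SymbolPair.IsRepeatedRootCyclic C ∧
        SymbolPair.IsMDS p 6 (C : Set (Fin (3 * p) → ZMod p))) ∧
    (∀ q : ℕ, IsPrimePow q → 3 ≤ q → ∀ n : ℕ, q + 4 ≤ n → n ∣ q ^ 2 - 1 →
      ∀ (F : Type*) [Field F] [Fintype F] [DecidableEq F], Fintype.card F = q →
      ∃ C : Submodule F (Fin n → F),
        SymbolPair.IsSimpleRootCyclic C ∧
        SymbolPair.IsAlmostMDS C ∧
        SymbolPair.IsMDS q 6 (C : Set (Fin n → F))) := by
  refine ⟨fun p _ h5 => SymbolPair.exists_repeatedRoot_isMDS_seven p h5,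
    fun p _ h3 => SymbolPair.exists_repeatedRoot_isMDS_eight p h3,
    fun p _ h5 => SymbolPair.exists_repeatedRoot_isMDS_six p h5, ?_⟩
  intro q _ _ n hn hdvd F _ _ _ hF
  subst hF
  exact SymbolPair.exists_simpleRoot_isMDS_six hn hdvd
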